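/- Let $P\subset\mathbb R^m$ be a nonempty polytope (the convex hull of a nonempty finite set), of dimension $d$, and let $\mathcal F(P)$ be the set of its nonempty faces, including $P$ itself. Let $\partial P$ be the union of the faces of $P$ other than $P$. Fix a choice of apexes $V(P)$: to every $F\in\mathcal F(P)$ a vertex $\mathbf v_F$ of $F$ is assigned, such that whenever $F_1,F_2\in\mathcal F(P)$ and $\mathbf v_{F_1},\mathbf v_{F_2}\in F_1\cap F_2$, then $\mathbf v_{F_1}=\mathbf v_{F_2}$ (for example, $\mathbf v_F$ is the point of $F$ minimizing a fixed linear function that takes distinct values at distinct vertices of $P$). The $V(P)$-polytope numbers $F(n)$ and the interior polytope numbers $F(n)^\sharp$ of the faces $F\in\mathcal F(P)$ ($n\ge 0$) are defined by double induction on $\dim F$ and $n$. If $\dim F=0$, then $F(0)=F(0)^\sharp=0$ and $F(n)=F(n)^\sharp=1$ for $n\ge 1$. If $\dim F\ge 1$, then $F(0)=0$, $F(1)=1$, $F(0)^\sharp=F(1)^\sharp=0$ and, for $n\ge 2$, $$F(n)=F(n-1)+\sum_{G\in\mathcal F(F),\ \mathbf v_F\notin G}G(n)^\sharp,\qquad F(n)^\sharp=F(n)-\sum_{G\in\mathcal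 F(F)\setminus\{F\}}G(n)^\sharp .$$ Theorem (vertex description of polytope numbers). We have $P(0)=P(0)^\sharp=0$ and $P(1)=1$, while $P(1)^\sharp=1$ if $d=0$ and $P(1)^\sharp=0$ if $d\ge 1$. For every $n\ge 2$, the set of sums in the first formula below is finite, and $$P(n)=\Big|\Big\{\sum_{i=1}^{n-1}\mathbf v_{F_i}\ \Big|\ F_1,\dots,F_{n-1}\in\mathcal F(P),\ F_1\supseteq F_2\supseteq\cdots\supseteq F_{n-1}\Big\}\Big|,$$ $$P(n)^\sharp=\Big|\Big\{\sum_{i=1}^{n-1}\mathbf v_{F_i}\ \Big|\ F_1,\dots,F_{n-1}\in\mathcal F(P),\ F_1\supseteq\cdots\supseteq F_{n-1},\ \operatorname{conv}\{\mathbf v_{F_1},\dots,\mathbf v_{F_{n-1}}\}\not\subseteq\partial P\Big\}\Big|.$$ -/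

import Mathlib

namespace PolytopeNumbers

variable {E : Type*} [NormedAddCommGroup E] [NormedSpace ℝ E]

/-- A (nonempty) polytope: the convex hull of a nonempty finite set of points. -/
def IsPolytope (P : Set E) : Prop :=
  ∃ s : Finset E, s.Nonempty ∧ P = convexHull ℝ (s : Set E)

/-- The nonempty faces of `P`, including `P` itself: the nonempty subsets of `P` on which some
linear form attains its maximum over `P`. -/
def faces (P : Set E) : Set (Set E) :=
  {F | F.Nonempty ∧ IsExposed ℝ P F}

/-- The nonempty faces of `P` other than `P` itself. -/
def properFaces (P : Set E) : Set (Set E) :=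
  {F | F ∈ faces P ∧ F ≠ P}

/-- The boundary of `P`: the points of `P` that lie in some proper face. -/
def boundary (P : Set E) : Set E :=
  {y | y ∈ P ∧ ∃ F ∈ properFaces P, y ∈ F}

/-- The dimension of `P`, that is, the dimension of its affine hull. -/
noncomputable def dim (P : Set E) : ℕ :=
  Module.finrank ℝ (vectorSpan ℝ P)

/-- An apex assignment for `P`: every nonempty face `F` has a designated vertex `v F` of `F`
(a vertex is a point that is by itself a face), and two faces whose apexes both lie in their
intersection have the same apex. -/
structure IsApexAssignment (P : Set E) (v : Set E → E) : Prop where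
  vertex : ∀ F ∈ faces P, v F ∈ F.exposedPoints ℝ
  consistent : ∀ F₁ ∈ faces P, ∀ F₂ ∈ faces P,
    v F₁ ∈ F₁ ∩ F₂ → v F₂ ∈ F₁ ∩ F₂ → v F₁ = v F₂

/-- A linear form in general position, that is, one with a unique minimum point on each face,
gives an apex assignment. -/
theorem IsApexAssignment.of_linear {P : Set E} {v : Set E → E} (l : E →L[ℝ] ℝ)
    (h : ∀ F ∈ faces P, v F ∈ F ∧ ∀ y ∈ F, y ≠ v F → l (v F) < l y) :
    IsApexAssignment P v where
  vertex F hF := by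
    refine ⟨(h F hF).1, -l, fun y hy => ?_⟩
    by_cases hyv : y = v F
    · subst hyv; simp
    · have := (h F hF).2 y hy hyv
      refine ⟨by simpa using this.le, fun h' => ?_⟩
      simp at h'
      linarith
  consistent F₁ h₁ F₂ h₂ hv₁ hv₂ := by
    by_contra hne
    have a := (h F₁ h₁).2 _ hv₂.1 (Ne.symm hne)
    have b := (h F₂ h₂).2 _ hv₁.2 hne
    linarith

/-- A polytope has finitely many faces, so the sums over faces below are finite sums. -/
theorem IsPolytope.finite_faces {P : Set E} (hP : IsPolytope P) : (faces P).Finite := by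
  obtain ⟨s, -, rfl⟩ := hP
  have key : ∀ F ∈ faces (convexHull ℝ (s : Set E)), F = convexHull ℝ ((s : Set E) ∩ F) := by
    rintro F ⟨hne, hF⟩
    have hcv : Convex ℝ F := hF.convex (convex_convexHull ℝ _)
    apply Set.Subset.antisymm
    · intro x hx
      obtain ⟨l, hl⟩ := hF hne
      have hx' := hx
      rw [hl] at hx'
      obtain ⟨hxP, hmax⟩ := hx'
      rw [Finset.mem_convexHull'] at hxP
      obtain ⟨w, hw0, hw1, hwx⟩ := hxP
      have hle : ∀ y ∈ s, l y ≤ l x := fun y hy => hmax y (subset_convexHull ℝ _ hy)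
      have hsum : ∑ y ∈ s, w y * (l x - l y) = 0 := by
        have : l x = ∑ y ∈ s, w y * l y := by
          conv_lhs => rw [← hwx]
          simp [map_sum]
        simp only [mul_sub, Finset.sum_sub_distrib, ← Finset.sum_mul, hw1]
        linarith
      have hz := (Finset.sum_eq_zero_iff_of_nonneg
        (fun y hy => mul_nonneg (hw0 y hy) (sub_nonneg.2 (hle y hy)))).1 hsum
      have hmem : ∀ y ∈ s, w y ≠ 0 → y ∈ (s : Set E) ∩ F := by
        intro y hy hwy
        refine ⟨hy, ?_⟩
        have h0 : l x - l y = 0 := (mul_eq_zero.1 (hz y hy)).resolve_left hwy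
        rw [hl]
        exact ⟨subset_convexHull ℝ _ hy, fun z hz => (hmax z hz).trans (by linarith)⟩
      rw [← hwx]
      classical
      rw [← Finset.sum_filter_of_ne (p := fun y => w y ≠ 0)
        (fun y _ h h0 => h (by simp [h0]))]
      refine (convex_convexHull ℝ _).sum_mem (fun y hy => hw0 y (Finset.mem_filter.1 hy).1) ?_ ?_
      · rw [Finset.sum_filter_ne_zero, hw1]
      · intro y hy
        exact subset_convexHull ℝ _ (hmem y (Finset.mem_filter.1 hy).1 (Finset.mem_filter.1 hy).2)
    · exact convexHull_min Set.inter_subset_right hcv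
  refine ((s.finite_toSet.finite_subsets).image (convexHull ℝ)).subset ?_
  intro F hF
  exact ⟨(s : Set E) ∩ F, Set.inter_subset_left, (key F hF).symm⟩

/-- A proper face has smaller dimension; this is what the recursion below runs on. -/
theorem dim_lt_of_mem_properFaces [FiniteDimensional ℝ E] {P F : Set E} (hF : F ∈ properFaces P) : dim F < dim P := by
  obtain ⟨⟨⟨p, hp⟩, hE⟩, hne⟩ := hF
  obtain ⟨l, hl⟩ := hE ⟨p, hp⟩
  have hsub : F ⊆ P := hE.subset
  obtain ⟨q, hqP, hqF⟩ : ∃ q ∈ P, q ∉ F := by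
    by_contra! h
    exact hne (Set.Subset.antisymm hsub h)
  have hpmax : ∀ y ∈ P, l y ≤ l p := by
    have := hp
    rw [hl] at this
    exact this.2
  have hlt : l q ≠ l p := by
    intro h
    apply hqF
    rw [hl]
    exact ⟨hqP, fun y hy => h ▸ hpmax y hy⟩
  have hker : vectorSpan ℝ F ≤ LinearMap.ker (l : E →ₗ[ℝ] ℝ) := by
    rw [vectorSpan_def, Submodule.span_le]
    rintro _ ⟨a, ha, b, hb, rfl⟩
    have ha' := ha
    have hb' := hb
    rw [hl] at ha' hb'
    have h1 := ha'.2 b hb'.1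
    have h2 := hb'.2 a ha'.1
    simp
    linarith
  apply Submodule.finrank_lt_finrank_of_lt
  refine lt_of_le_of_ne (vectorSpan_mono ℝ hsub) fun heq => hlt ?_
  have hm : q -ᵥ p ∈ vectorSpan ℝ F := heq ▸ vsub_mem_vectorSpan ℝ hqP (hsub hp)
  have := hker hm
  simp at this
  linarith

mutual

/-- The polytope numbers `P(n)` with respect to the apexes `v`: for a point they are
`0, 1, 1, 1, …`; in positive dimension `P(0) = 0`, `P(1) = 1`, and for `n ≥ 2` the number `P(n)`
is `P(n-1)` plus the sum of `F(n)^♯` over the faces `F` that do not contain the apex of `P`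
(such a face is automatically different from `P`). -/
noncomputable def polytopeNumber [FiniteDimensional ℝ E] (v : Set E → E) (P : Set E)
    (n : ℕ) : ℤ :=
  match n with
  | 0 => 0
  | 1 => 1
  | n + 2 =>
    if dim P = 0 then 1
    else polytopeNumber v P (n + 1) +
      ∑ᶠ F : {F : Set E // F ∈ properFaces P ∧ v P ∉ F}, interiorPolytopeNumber v F.1 (n + 2)
termination_by (dim P, n, 0)
decreasing_by
  · exact Prod.Lex.right _ (Prod.Lex.left _ _ (by omega))
  · exact Prod.Lex.left _ _ (dim_lt_of_mem_properFaces F.2.1)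

/-- The interior polytope numbers `P(n)^♯` with respect to the apexes `v`: for a point they are
`0, 1, 1, 1, …`; in positive dimension `P(0)^♯ = P(1)^♯ = 0`, and for `n ≥ 2` the number `P(n)^♯`
is `P(n)` minus the sum of `F(n)^♯` over the proper faces `F`. -/
noncomputable def interiorPolytopeNumber [FiniteDimensional ℝ E] (v : Set E → E) (P : Set E)
    (n : ℕ) : ℤ :=
  match n with
  | 0 => 0
  | 1 => if dim P = 0 then 1 else 0
  | n + 2 =>
    if dim P = 0 then 1
    else polytopeNumber v P (n + 2) -
      ∑ᶠ F : {F : Set E // F ∈ properFaces P}, interiorPolytopeNumber v F.1 (n + 2)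
termination_by (dim P, n, 1)
decreasing_by
  · exact Prod.Lex.right _ (Prod.Lex.right _ (by omega))
  · exact Prod.Lex.left _ _ (dim_lt_of_mem_properFaces F.2)

end

/-- The sums `v_{F_1} + ⋯ + v_{F_k}` over weakly decreasing chains `F_1 ⊇ ⋯ ⊇ F_k` of nonempty
faces of `P`. -/
def chainSums (v : Set E → E) (P : Set E) (k : ℕ) : Set E :=
  {x | ∃ F : Fin k → Set E, (∀ i, F i ∈ faces P) ∧ Antitone F ∧ x = ∑ i, v (F i)}

/-- The sums `v_{F_1} + ⋯ + v_{F_k}` over those weakly decreasing chains `F_1 ⊇ ⋯ ⊇ F_k` of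
nonempty faces of `P` for which the convex hull of the apexes is not contained in the boundary
of `P`. -/
def interiorChainSums (v : Set E → E) (P : Set E) (k : ℕ) : Set E :=
  {x | ∃ F : Fin k → Set E, (∀ i, F i ∈ faces P) ∧ Antitone F ∧
    ¬ convexHull ℝ (Set.range fun i => v (F i)) ⊆ boundary P ∧ x = ∑ i, v (F i)}

end PolytopeNumbers

-- The right-hand sides satisfy the recursions that define polytope numbers. The tool is the
-- barycenter of the apexes of a chain. Every point of `P` lies in the relative interior of exactly
-- one face, and a face containing the barycenter of points of `P` contains all of them. Hence the
-- convex hull of the apexes avoids being swallowed by the boundary exactly when the barycenter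
-- does, a condition on the sum alone.
--
-- If the barycenter lies in the relative interior of a face `F`, all apexes lie in `F`.
-- Intersecting the chain with `F` then preserves the apexes by consistency, so the sum is an
-- interior sum of `F` (`mem_interiorChainSums_iff`). Thus the sums of `P` are the disjoint union of
-- the interior sums of its faces, which is the recursion for the interior numbers.
--
-- For the other recursion, either the largest face of a chain contains the apex of `P`, which is
-- then its own apex and can be split off, or the sum is an interior sum of a face missing that apex
-- (`chainSums_succ`). The two cases exclude each other, again by barycenters.

namespace PolytopeNumbers

-- Faces, relative interiors and barycenters

section Faces

variable {E : Type*} [NormedAddCommGroup E] [NormedSpace ℝ E]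

/-- An exposed subset of the convex hull of a finite set is spanned by the points it contains. -/
theorem exposed_subset_convexHull_inter {s : Finset E} {F : Set E}
    (hF : IsExposed ℝ (convexHull ℝ (s : Set E)) F) : F ⊆ convexHull ℝ ((s : Set E) ∩ F) := by
  classical
  intro x hx
  obtain ⟨l, hl⟩ := hF ⟨x, hx⟩
  obtain ⟨hxP, hmax⟩ := hl ▸ hx
  rw [Finset.mem_convexHull'] at hxP
  obtain ⟨w, hw0, hw1, hwx⟩ := hxP
  have hle : ∀ y ∈ s, l y ≤ l x := fun y hy => hmax y (subset_convexHull ℝ _ hy)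
  -- All terms are nonnegative because `x` maximizes `l`; so the weights vanish at generators
  -- outside `F`.
  have hsum : ∑ y ∈ s, w y * (l x - l y) = 0 := by
    have : l x = ∑ y ∈ s, w y * l y := by
      conv_lhs => rw [← hwx]
      simp [map_sum]
    simp only [mul_sub, Finset.sum_sub_distrib, ← Finset.sum_mul, hw1]
    linarith
  have hz := (Finset.sum_eq_zero_iff_of_nonneg
    (fun y hy => mul_nonneg (hw0 y hy) (sub_nonneg.2 (hle y hy)))).1 hsum
  have hmem : ∀ y ∈ s, w y ≠ 0 → y ∈ (s : Set E) ∩ F := by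
    intro y hy hwy
    refine ⟨hy, ?_⟩
    have h0 : l x - l y = 0 := (mul_eq_zero.1 (hz y hy)).resolve_left hwy
    rw [hl]
    exact ⟨subset_convexHull ℝ _ hy, fun z hz => (hmax z hz).trans (by linarith)⟩
  rw [← hwx, ← Finset.sum_filter_of_ne (p := fun y => w y ≠ 0) (fun y _ h h0 => h (by simp [h0]))]
  refine (convex_convexHull ℝ _).sum_mem (fun y hy => hw0 y (Finset.mem_filter.1 hy).1) ?_ ?_
  · rw [Finset.sum_filter_ne_zero, hw1]
  · intro y hy
    exact subset_convexHull ℝ _ (hmem y (Finset.mem_filter.1 hy).1 (Finset.mem_filter.1 hy).2)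

theorem IsPolytope.convex {P : Set E} (hP : IsPolytope P) : Convex ℝ P := by
  obtain ⟨s, -, rfl⟩ := hP
  exact convex_convexHull ℝ _

theorem IsPolytope.self_mem_faces {P : Set E} (hP : IsPolytope P) : P ∈ faces P := by
  obtain ⟨s, hs, rfl⟩ := hP
  exact ⟨(convexHull_nonempty_iff).2 hs, IsExposed.refl _⟩

theorem IsPolytope.of_mem_faces {P F : Set E} (hP : IsPolytope P) (hF : F ∈ faces P) :
    IsPolytope F := by
  classical
  obtain ⟨s, -, rfl⟩ := hP
  have hcv : Convex ℝ F := hF.2.convex (convex_convexHull ℝ _)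
  have hsub := exposed_subset_convexHull_inter hF.2
  have heq : ((s.filter (· ∈ F) : Finset E) : Set E) = (s : Set E) ∩ F := by ext; simp
  refine ⟨s.filter (· ∈ F), ?_, ?_⟩
  · rw [← Finset.coe_nonempty, heq, ← convexHull_nonempty_iff (𝕜 := ℝ)]
    exact hF.1.mono hsub
  · rw [heq]
    exact hsub.antisymm (convexHull_min Set.inter_subset_right hcv)

/-- A face of `P` contained in a face `F` of `P` is a face of `F`. -/
theorem mem_faces_of_subset {P F G : Set E} (hF : F ∈ faces P) (hG : G ∈ faces P) (h : G ⊆ F) :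
    G ∈ faces F :=
  ⟨hG.1, hG.2.mono hF.2.subset h⟩

theorem inter_mem_faces {P F G : Set E} (hF : F ∈ faces P) (hG : G ∈ faces P)
    (h : (F ∩ G).Nonempty) : F ∩ G ∈ faces P :=
  ⟨h, hF.2.inter hG.2⟩

/-- A face of a face of a polytope is a face. -/
theorem IsPolytope.faces_trans {P F G : Set E} (hP : IsPolytope P) (hF : F ∈ faces P)
    (hG : G ∈ faces F) : G ∈ faces P := by
  obtain ⟨s, -, rfl⟩ := hP
  obtain ⟨p, hp⟩ := hG.1
  obtain ⟨l, hl⟩ := hF.2 hF.1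
  obtain ⟨l', hl'⟩ := hG.2 hG.1
  have hpF : p ∈ F := hG.2.subset hp
  have hpmax : ∀ y ∈ convexHull ℝ (s : Set E), l y ≤ l p := by
    have := hpF
    rw [hl] at this
    exact this.2
  have hpmax' : ∀ y ∈ F, l' y ≤ l' p := by
    have := hp
    rw [hl'] at this
    exact this.2
  have hlt : ∀ y ∈ s, y ∉ F → l y < l p := by
    intro y hy hyF
    have hyP := subset_convexHull ℝ (s : Set E) hy
    refine lt_of_le_of_ne (hpmax y hyP) fun h => hyF ?_
    rw [hl]
    exact ⟨hyP, fun z hz => h ▸ hpmax z hz⟩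
  -- A large multiple of `l` outweighs `l'` at the finitely many generators outside `F`, while on
  -- `F` the form `l` is constant. So `N • l + l'` exposes `G` in the whole polytope.
  obtain ⟨N, hN⟩ : ∃ N : ℝ, ∀ y ∈ s, y ∉ F → l' y - l' p < N * (l p - l y) := by
    refine Filter.Eventually.exists (f := Filter.atTop) ?_
    rw [Filter.eventually_all_finset]
    intro y hy
    by_cases hyF : y ∈ F
    · simp [hyF]
    · have h := sub_pos.2 (hlt y hy hyF)
      filter_upwards [(Filter.tendsto_id.atTop_mul_const h).eventually_gt_atTop (l' y - l' p)]
        with N hN _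
      exact hN
  set g : StrongDual ℝ E := N • l + l' with hg
  have hgv : ∀ y, g y = N * l y + l' y := fun y => by simp [hg]
  have hsle : ∀ y ∈ s, g y ≤ g p ∧ (g y = g p → y ∈ G) := by
    intro y hy
    rw [hgv, hgv]
    by_cases hyF : y ∈ F
    · have h1 : l y = l p := by
        have := hyF
        rw [hl] at this
        exact le_antisymm (hpmax y this.1) (this.2 p (hF.2.subset hpF))
      rw [h1]
      refine ⟨by linarith [hpmax' y hyF], fun h => ?_⟩
      rw [hl']
      exact ⟨hyF, fun z hz => (hpmax' z hz).trans (by linarith)⟩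
    · have := hN y hy hyF
      exact ⟨by nlinarith, fun h => by nlinarith⟩
  have hgle : ∀ y ∈ convexHull ℝ (s : Set E), g y ≤ g p := by
    have : convexHull ℝ (s : Set E) ⊆ {y | g y ≤ g p} :=
      convexHull_min (fun y hy => (hsle y hy).1)
        (convex_halfSpace_le g.toLinearMap.isLinear _)
    exact this
  refine ⟨hG.1, fun _ => ⟨g, Set.Subset.antisymm (fun x hx => ?_) ?_⟩⟩
  · have hxF : x ∈ F := hG.2.subset hx
    refine ⟨hF.2.subset hxF, fun y hy => (hgle y hy).trans ?_⟩
    rw [hl] at hxF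
    rw [hl'] at hx
    rw [hgv, hgv, le_antisymm (hpmax x hxF.1) (hxF.2 p (hF.2.subset hpF))]
    linarith [hx.2 p hpF]
  · have hexp : IsExposed ℝ (convexHull ℝ (s : Set E))
        {x ∈ convexHull ℝ (s : Set E) | ∀ y ∈ convexHull ℝ (s : Set E), g y ≤ g x} :=
      fun _ => ⟨g, rfl⟩
    refine (exposed_subset_convexHull_inter hexp).trans (convexHull_min ?_
      (hG.2.convex (hF.2.convex (convex_convexHull ℝ _))))
    rintro y ⟨hys, hyP, hy⟩
    exact (hsle y hys).2 (le_antisymm (hgle y hyP) (hy p (hF.2.subset hpF)))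

/-- The points of `P` that lie in no proper face. -/
def openFace (P : Set E) : Set E :=
  P \ boundary P

/-- Otherwise `F ∩ G` would be a proper face of `F` through `y`. Applied in both directions, this
shows that relative interiors of distinct faces are disjoint. -/
theorem eq_of_mem_openFace {P F G : Set E} {y : E} (hF : F ∈ faces P) (hG : G ∈ faces P)
    (hyF : y ∈ openFace F) (hyG : y ∈ G) : F ⊆ G := by
  have hmem := mem_faces_of_subset hF (inter_mem_faces hF hG ⟨y, hyF.1, hyG⟩)
    Set.inter_subset_left
  by_contra h
  refine hyF.2 ⟨hyF.1, F ∩ G, ⟨hmem, ?_⟩, hyF.1, hyG⟩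
  rwa [Ne, Set.inter_eq_left]

/-- A minimal face through `y` works: a proper face of it through `y` would be a smaller face of
`P`. -/
theorem IsPolytope.exists_mem_openFace {P : Set E} (hP : IsPolytope P) {y : E} (hy : y ∈ P) :
    ∃ F ∈ faces P, y ∈ openFace F := by
  have hfin : {F | F ∈ faces P ∧ y ∈ F}.Finite := hP.finite_faces.subset fun F hF => hF.1
  obtain ⟨F, hF⟩ := hfin.exists_minimal ⟨P, hP.self_mem_faces, hy⟩
  refine ⟨F, hF.prop.1, hF.prop.2, ?_⟩
  rintro ⟨-, G, ⟨hG, hne⟩, hyG⟩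
  have hGF : G ⊆ F := hG.2.subset
  exact hne (hGF.antisymm (hF.le_of_le ⟨hP.faces_trans hF.prop.1 hG, hyG⟩ hGF))

theorem barycenter_mem {C : Set E} (hC : Convex ℝ C) {k : ℕ} {x : Fin (k + 1) → E}
    (hx : ∀ i, x i ∈ C) : ((k : ℝ) + 1)⁻¹ • ∑ i, x i ∈ C := by
  rw [Finset.smul_sum]
  refine hC.sum_mem (fun i _ => by positivity) ?_ fun i _ => hx i
  simp only [Finset.sum_const, Finset.card_univ, Fintype.card_fin, nsmul_eq_mul, Nat.cast_add,
    Nat.cast_one]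
  exact mul_inv_cancel₀ (by positivity)

/-- A face containing the barycenter of some points of `P` contains all of them. -/
theorem mem_of_barycenter_mem {P F : Set E} (hF : F ∈ faces P) {k : ℕ}
    {x : Fin (k + 1) → E} (hx : ∀ i, x i ∈ P) (h : ((k : ℝ) + 1)⁻¹ • ∑ i, x i ∈ F)
    (i : Fin (k + 1)) : x i ∈ F := by
  obtain ⟨l, hl⟩ := hF.2 hF.1
  set b := ((k : ℝ) + 1)⁻¹ • ∑ i, x i with hb
  have hk : (k : ℝ) + 1 ≠ 0 := by positivity
  have hmax : ∀ y ∈ P, l y ≤ l b := by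
    rw [hl] at h
    exact h.2
  have hsum : ∑ j, (l b - l (x j)) = 0 := by
    have h1 : ((k : ℝ) + 1) * l b = ∑ j, l (x j) := by
      rw [hb, map_smul, smul_eq_mul, mul_inv_cancel_left₀ hk, map_sum]
    simp [Finset.sum_sub_distrib, ← h1]
  have h0 := (Finset.sum_eq_zero_iff_of_nonneg
    (fun j _ => sub_nonneg.2 (hmax (x j) (hx j)))).1 hsum i (Finset.mem_univ i)
  rw [hl]
  exact ⟨hx i, fun y hy => (hmax y hy).trans (by linarith)⟩

/-- A proper face containing the barycenter contains all the points, hence their hull. The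
interiority of a chain therefore depends only on the sum of its apexes. -/
theorem convexHull_range_subset_boundary_iff {P : Set E} (hP : Convex ℝ P) {k : ℕ}
    {x : Fin (k + 1) → E} (hx : ∀ i, x i ∈ P) :
    convexHull ℝ (Set.range x) ⊆ boundary P ↔ ((k : ℝ) + 1)⁻¹ • ∑ i, x i ∈ boundary P := by
  refine ⟨fun h => h (barycenter_mem (convex_convexHull ℝ _) fun i =>
    subset_convexHull ℝ _ ⟨i, rfl⟩), ?_⟩
  rintro ⟨-, F, hF, hb⟩
  have hsub : convexHull ℝ (Set.range x) ⊆ F := by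
    refine convexHull_min ?_ (hF.1.2.convex hP)
    rintro _ ⟨i, rfl⟩
    exact mem_of_barycenter_mem hF.1 hx hb i
  exact fun y hy => ⟨hF.1.2.subset (hsub hy), F, hF, hsub hy⟩

end Faces

-- Decompositions of the sets of chain sums

section ChainSums

variable {E : Type*} [NormedAddCommGroup E] [NormedSpace ℝ E] {P F : Set E} {v : Set E → E}

theorem IsApexAssignment.mem (hv : IsApexAssignment P v) (hF : F ∈ faces P) : v F ∈ F :=
  (hv.vertex F hF).1

theorem IsApexAssignment.of_mem_faces (hP : IsPolytope P) (hv : IsApexAssignment P v)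
    (hF : F ∈ faces P) : IsApexAssignment F v where
  vertex G hG := hv.vertex G (hP.faces_trans hF hG)
  consistent G hG H hH := hv.consistent G (hP.faces_trans hF hG) H (hP.faces_trans hF hH)

/-- A face has the same apex as each of its faces that contains this apex. -/
theorem IsApexAssignment.apex_eq (hv : IsApexAssignment P v) {F G : Set E} (hF : F ∈ faces P)
    (hG : G ∈ faces P) (hGF : G ⊆ F) (h : v F ∈ G) : v G = v F :=
  hv.consistent G hG F hF ⟨hv.mem hG, hGF (hv.mem hG)⟩ ⟨h, hv.mem hF⟩

theorem IsPolytope.finite_chainSums (hP : IsPolytope P) (v : Set E → E) (k : ℕ) :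
    (chainSums v P k).Finite := by
  have := hP.finite_faces.to_subtype
  refine (Set.finite_range fun F : Fin k → faces P => ∑ i, v (F i)).subset ?_
  rintro x ⟨F, hF, -, rfl⟩
  exact ⟨fun i => ⟨F i, hF i⟩, rfl⟩

theorem IsPolytope.chainSums_subset (hP : IsPolytope P) (hF : F ∈ faces P) (k : ℕ) :
    chainSums v F k ⊆ chainSums v P k := by
  rintro x ⟨G, hG, hanti, rfl⟩
  exact ⟨G, fun i => hP.faces_trans hF (hG i), hanti, rfl⟩

theorem chainSums_barycenter_mem (hP : IsPolytope P) (hv : IsApexAssignment P v) {k : ℕ} {x : E}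
    (hx : x ∈ chainSums v P (k + 1)) : ((k : ℝ) + 1)⁻¹ • x ∈ P := by
  obtain ⟨F, hF, -, rfl⟩ := hx
  exact barycenter_mem hP.convex fun i => (hF i).2.subset (hv.mem (hF i))

/-- The interior chain sums of a face `F` of `P` are the chain sums of `P` whose barycenter lies
in `F` but in no proper face of `F`. -/
theorem mem_interiorChainSums_iff (hP : IsPolytope P) (hv : IsApexAssignment P v)
    (hF : F ∈ faces P) {k : ℕ} {x : E} :
    x ∈ interiorChainSums v F (k + 1) ↔
      x ∈ chainSums v P (k + 1) ∧ ((k : ℝ) + 1)⁻¹ • x ∈ openFace F := by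
  have hFP := hP.of_mem_faces hF
  constructor
  · rintro ⟨G, hG, hanti, hconv, rfl⟩
    have hmem : ∀ i, v (G i) ∈ F := fun i =>
      (hG i).2.subset (hv.mem (hP.faces_trans hF (hG i)))
    rw [convexHull_range_subset_boundary_iff hFP.convex hmem] at hconv
    exact ⟨⟨G, fun i => hP.faces_trans hF (hG i), hanti, rfl⟩,
      barycenter_mem hFP.convex hmem, hconv⟩
  · rintro ⟨⟨G, hG, hanti, rfl⟩, hb⟩
    have hmem : ∀ i, v (G i) ∈ F := mem_of_barycenter_mem hF
      (fun i => (hG i).2.subset (hv.mem (hG i))) hb.1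
    -- The chain is cut down to `F`; since `F` contains every apex, consistency leaves the apexes
    -- unchanged.
    have hGF : ∀ i, G i ∩ F ∈ faces P := fun i =>
      inter_mem_faces (hG i) hF ⟨_, hv.mem (hG i), hmem i⟩
    have hvG : ∀ i, v (G i ∩ F) = v (G i) := fun i =>
      hv.apex_eq (hG i) (hGF i) Set.inter_subset_left ⟨hv.mem (hG i), hmem i⟩
    refine ⟨fun i => G i ∩ F, fun i => mem_faces_of_subset hF (hGF i) Set.inter_subset_right,
      fun i j hij => Set.inter_subset_inter_left _ (hanti hij), ?_, ?_⟩
    · simp only [hvG]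
      rw [convexHull_range_subset_boundary_iff hFP.convex hmem]
      exact hb.2
    · simp only [hvG]

theorem disjoint_interiorChainSums (hP : IsPolytope P) (hv : IsApexAssignment P v) {F G : Set E}
    (hF : F ∈ faces P) (hG : G ∈ faces P) (hne : F ≠ G) (k : ℕ) :
    Disjoint (interiorChainSums v F (k + 1)) (interiorChainSums v G (k + 1)) := by
  rw [Set.disjoint_left]
  intro x hxF hxG
  rw [mem_interiorChainSums_iff hP hv hF] at hxF
  rw [mem_interiorChainSums_iff hP hv hG] at hxG
  exact hne ((eq_of_mem_openFace hF hG hxF.2 hxG.2.1).antisymm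
    (eq_of_mem_openFace hG hF hxG.2 hxF.2.1))

theorem exists_mem_interiorChainSums (hP : IsPolytope P) (hv : IsApexAssignment P v) {k : ℕ}
    {x : E} (hx : x ∈ chainSums v P (k + 1)) :
    ∃ F ∈ faces P, x ∈ interiorChainSums v F (k + 1) := by
  obtain ⟨F, hF, hxF⟩ := hP.exists_mem_openFace (chainSums_barycenter_mem hP hv hx)
  exact ⟨F, hF, (mem_interiorChainSums_iff hP hv hF).2 ⟨hx, hxF⟩⟩

theorem interiorChainSums_subset (v : Set E → E) (P : Set E) (k : ℕ) :
    interiorChainSums v P k ⊆ chainSums v P k := by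
  rintro x ⟨G, hG, hanti, -, rfl⟩
  exact ⟨G, hG, hanti, rfl⟩

/-- Every chain sum of `P` is an interior chain sum of `P` or of a proper face. -/
theorem chainSums_eq_union_interior (hP : IsPolytope P) (hv : IsApexAssignment P v) (k : ℕ) :
    chainSums v P (k + 1) = interiorChainSums v P (k + 1) ∪
      ⋃ F : {F : Set E // F ∈ properFaces P}, interiorChainSums v F.1 (k + 1) := by
  apply Set.Subset.antisymm
  · intro x hx
    obtain ⟨F, hF, hxF⟩ := exists_mem_interiorChainSums hP hv hx
    by_cases h : F = P
    · exact Or.inl (h ▸ hxF)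
    · exact Or.inr (Set.mem_iUnion.2 ⟨⟨F, hF, h⟩, hxF⟩)
  · refine Set.union_subset (interiorChainSums_subset v P _) (Set.iUnion_subset fun F => ?_)
    exact (interiorChainSums_subset v F.1 _).trans (hP.chainSums_subset F.2.1 _)

/-- A chain sum of `P` either uses the apex of `P`, or it is an interior chain sum of a face that
does not contain the apex. -/
theorem chainSums_succ (hP : IsPolytope P) (hv : IsApexAssignment P v) (k : ℕ) :
    chainSums v P (k + 1) = (fun x => v P + x) '' chainSums v P k ∪
      ⋃ F : {F : Set E // F ∈ properFaces P ∧ v P ∉ F}, interiorChainSums v F.1 (k + 1) := by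
  apply Set.Subset.antisymm
  · rintro x ⟨G, hG, hanti, rfl⟩
    -- `G 0` is the largest face of the chain: if it contains `v P`, that is its apex; if not, no
    -- face of `G 0` contains `v P`.
    by_cases h : v P ∈ G 0
    · left
      refine ⟨∑ i : Fin k, v (G i.succ), ⟨fun i => G i.succ, fun i => hG _, ?_, rfl⟩, ?_⟩
      · exact hanti.comp_monotone (Fin.strictMono_succ).monotone
      · simp only [Fin.sum_univ_succ]
        rw [hv.apex_eq hP.self_mem_faces (hG 0) (hG 0).2.subset h]
    · right
      have hG0 := hP.of_mem_faces (hG 0)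
      have hx : ∑ i, v (G i) ∈ chainSums v (G 0) (k + 1) :=
        ⟨G, fun i => mem_faces_of_subset (hG 0) (hG i) (hanti (Fin.zero_le i)), hanti, rfl⟩
      obtain ⟨F, hF, hxF⟩ :=
        exists_mem_interiorChainSums hG0 (hv.of_mem_faces hP (hG 0)) hx
      have hvF : v P ∉ F := fun h' => h (hF.2.subset h')
      refine Set.mem_iUnion.2 ⟨⟨F, ⟨hP.faces_trans (hG 0) hF, ?_⟩, hvF⟩, hxF⟩
      rintro rfl
      exact hvF (hv.mem hP.self_mem_faces)
  · refine Set.union_subset ?_ (Set.iUnion_subset fun F => ?_)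
    · rintro _ ⟨x, ⟨G, hG, hanti, rfl⟩, rfl⟩
      -- Prepending `P`, the largest face, keeps the chain decreasing and adds `v P`.
      refine ⟨Fin.cons P G, ?_, ?_, ?_⟩
      · intro i
        cases i using Fin.cases with
        | zero => exact hP.self_mem_faces
        | succ i => exact hG i
      · intro i j hij
        cases i using Fin.cases with
        | zero =>
          cases j using Fin.cases with
          | zero => exact le_rfl
          | succ j => exact (hG j).2.subset
        | succ i =>
          cases j using Fin.cases with
          | zero => simp at hij
          | succ j => exact hanti (Fin.succ_le_succ_iff.1 hij)
      · simp [Fin.sum_univ_succ]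
    · exact (interiorChainSums_subset v F.1 _).trans (hP.chainSums_subset F.2.1.1 _)

theorem ncard_iUnion_interiorChainSums (hP : IsPolytope P) (hv : IsApexAssignment P v)
    (q : Set E → Prop) (hq : ∀ F, q F → F ∈ faces P) (k : ℕ) :
    (⋃ F : {F : Set E // q F}, interiorChainSums v F.1 (k + 1)).Finite ∧
    ((⋃ F : {F : Set E // q F}, interiorChainSums v F.1 (k + 1)).ncard : ℤ) =
      ∑ᶠ F : {F : Set E // q F}, ((interiorChainSums v F.1 (k + 1)).ncard : ℤ) := by
  have : Finite {F : Set E // q F} := (hP.finite_faces.subset hq).to_subtype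
  have hfin : ∀ F : {F : Set E // q F}, (interiorChainSums v F.1 (k + 1)).Finite := fun F =>
    ((hP.of_mem_faces (hq _ F.2)).finite_chainSums v _).subset (interiorChainSums_subset v F.1 _)
  refine ⟨Set.finite_iUnion hfin, ?_⟩
  rw [Set.ncard_iUnion_of_finite hfin fun F G hne => disjoint_interiorChainSums hP hv
    (hq _ F.2) (hq _ G.2) (fun h => hne (Subtype.ext h)) k]
  exact (Nat.castAddMonoidHom ℤ).map_finsum (Set.toFinite _)

theorem ncard_chainSums_eq_interior (hP : IsPolytope P) (hv : IsApexAssignment P v) (k : ℕ) :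
    ((chainSums v P (k + 1)).ncard : ℤ) = (interiorChainSums v P (k + 1)).ncard +
      ∑ᶠ F : {F : Set E // F ∈ properFaces P}, ((interiorChainSums v F.1 (k + 1)).ncard : ℤ) := by
  obtain ⟨hfin, hcard⟩ :=
    ncard_iUnion_interiorChainSums hP hv (· ∈ properFaces P) (fun F hF => hF.1) k
  rw [chainSums_eq_union_interior hP hv, Set.ncard_union_eq ?_ ?_ hfin, Nat.cast_add, hcard]
  · exact Set.disjoint_iUnion_right.2 fun F =>
      disjoint_interiorChainSums hP hv hP.self_mem_faces F.2.1 F.2.2.symm k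
  · exact (hP.finite_chainSums v _).subset (interiorChainSums_subset v P _)

/-- The pieces of `chainSums_succ` are disjoint: a face containing the barycenter of a sum with
summand `v P` contains `v P`. Translation by `v P` is injective, so the first piece keeps its
cardinality. -/
theorem ncard_chainSums_succ (hP : IsPolytope P) (hv : IsApexAssignment P v) (k : ℕ) :
    ((chainSums v P (k + 1)).ncard : ℤ) = (chainSums v P k).ncard +
      ∑ᶠ F : {F : Set E // F ∈ properFaces P ∧ v P ∉ F},
        ((interiorChainSums v F.1 (k + 1)).ncard : ℤ) := by
  obtain ⟨hfin, hcard⟩ := ncard_iUnion_interiorChainSums hP hv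
    (fun F => F ∈ properFaces P ∧ v P ∉ F) (fun F hF => hF.1.1) k
  rw [chainSums_succ hP hv, Set.ncard_union_eq ?_ ((hP.finite_chainSums v k).image _) hfin,
    Nat.cast_add, hcard, Set.ncard_image_of_injective _ (add_right_injective _)]
  rw [Set.disjoint_left]
  rintro _ ⟨x, ⟨G, hG, -, rfl⟩, rfl⟩ hx
  obtain ⟨⟨F, hF, hvF⟩, hxF⟩ := Set.mem_iUnion.1 hx
  rw [mem_interiorChainSums_iff hP hv hF.1] at hxF
  have hb := hxF.2.1
  have hsum : v P + ∑ i, v (G i) = ∑ i, (Fin.cons (v P) fun i => v (G i) : Fin (k + 1) → E) i := by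
    simp [Fin.sum_univ_succ]
  beta_reduce at hb
  rw [hsum] at hb
  refine hvF (mem_of_barycenter_mem hF.1 (fun i => ?_) hb 0)
  cases i using Fin.cases with
  | zero => exact hv.mem hP.self_mem_faces
  | succ i => exact (hG i).2.subset (hv.mem (hG i))

/-- The empty chain contributes the sum `0`; this is the initial value `P(1) = 1`. -/
theorem ncard_chainSums_zero (hP : IsPolytope P) (v : Set E → E) :
    (chainSums v P 0).ncard = 1 := by
  have : chainSums v P 0 = {0} := by
    ext x
    simp only [chainSums, Set.mem_ofPred_eq, Finset.univ_eq_empty, Finset.sum_empty,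
      Set.mem_singleton_iff]
    exact ⟨fun ⟨_, _, _, h⟩ => h, fun h => ⟨fun _ => P, fun _ => hP.self_mem_faces,
      antitone_const, h⟩⟩
  rw [this, Set.ncard_singleton]

-- Comparison with the recursive definition

variable [FiniteDimensional ℝ E]

theorem properFaces_eq_empty (h : dim P = 0) : properFaces P = ∅ := by
  refine Set.eq_empty_of_forall_notMem fun F hF => ?_
  have := dim_lt_of_mem_properFaces hF
  omega

/-- The recursion for polytope numbers also holds in dimension zero. -/
theorem polytopeNumber_add_two (v : Set E → E) (P : Set E) (n : ℕ) :
    polytopeNumber v P (n + 2) = polytopeNumber v P (n + 1) +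
      ∑ᶠ F : {F : Set E // F ∈ properFaces P ∧ v P ∉ F},
        interiorPolytopeNumber v F.1 (n + 2) := by
  rw [polytopeNumber]
  split_ifs with h
  · have : IsEmpty {F : Set E // F ∈ properFaces P ∧ v P ∉ F} :=
      ⟨fun F => by simpa [properFaces_eq_empty h] using F.2.1⟩
    rw [finsum_of_isEmpty, add_zero]
    -- The value at `1` comes from a separate clause of the definition.
    cases n <;> simp [polytopeNumber, h]
  · rfl

theorem interiorPolytopeNumber_add_two (v : Set E → E) (P : Set E) (n : ℕ) :
    interiorPolytopeNumber v P (n + 2) = polytopeNumber v P (n + 2) -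
      ∑ᶠ F : {F : Set E // F ∈ properFaces P}, interiorPolytopeNumber v F.1 (n + 2) := by
  rw [interiorPolytopeNumber]
  split_ifs with h
  · have : IsEmpty {F : Set E // F ∈ properFaces P} :=
      ⟨fun F => by simpa [properFaces_eq_empty h] using F.2⟩
    rw [finsum_of_isEmpty, sub_zero]
    simp [polytopeNumber, h]
  · rfl

/-- Both claims go through one induction on dimension, as each recursion calls interior numbers of
proper faces; the first also needs an induction on `k`. The interior claim must start at `2`: the
empty chain has empty hull, so it would give `0` at index `1`, whereas a point has interior number
`1` there. -/
theorem polytopeNumber_eq_ncard (hP : IsPolytope P) (hv : IsApexAssignment P v) :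
    (∀ k, polytopeNumber v P (k + 1) = (chainSums v P k).ncard) ∧
      ∀ k, interiorPolytopeNumber v P (k + 2) = (interiorChainSums v P (k + 1)).ncard := by
  induction hd : dim P using Nat.strong_induction_on generalizing P with
  | _ d ih =>
    subst hd
    have hface : ∀ F ∈ properFaces P, ∀ k,
        interiorPolytopeNumber v F (k + 2) = (interiorChainSums v F (k + 1)).ncard :=
      fun F hF => (ih _ (dim_lt_of_mem_properFaces hF) (hP.of_mem_faces hF.1)
        (hv.of_mem_faces hP hF.1) rfl).2
    have hnum : ∀ k, polytopeNumber v P (k + 1) = (chainSums v P k).ncard := by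
      intro k
      induction k with
      | zero => simp [polytopeNumber, ncard_chainSums_zero hP]
      | succ k ihk =>
        rw [polytopeNumber_add_two, ihk, ncard_chainSums_succ hP hv]
        congr 1
        exact finsum_congr fun F => hface _ F.2.1 k
    refine ⟨hnum, fun k => ?_⟩
    rw [interiorPolytopeNumber_add_two, hnum, ncard_chainSums_eq_interior hP hv,
      finsum_congr fun F : {F : Set E // F ∈ properFaces P} => hface _ F.2 k]
    ring

end ChainSums

end PolytopeNumbers

theorem mainTheorem5 (m : ℕ) (P : Set (EuclideanSpace ℝ (Fin m)))
    (hP : PolytopeNumbers.IsPolytope P)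
    (v : Set (EuclideanSpace ℝ (Fin m)) → EuclideanSpace ℝ (Fin m))
    (hv : PolytopeNumbers.IsApexAssignment P v) :
    PolytopeNumbers.polytopeNumber v P 0 = 0 ∧
    PolytopeNumbers.interiorPolytopeNumber v P 0 = 0 ∧
    PolytopeNumbers.polytopeNumber v P 1 = 1 ∧
    PolytopeNumbers.interiorPolytopeNumber v P 1 =
      (if PolytopeNumbers.dim P = 0 then 1 else 0) ∧
    ∀ n : ℕ, 2 ≤ n →
      (PolytopeNumbers.chainSums v P (n - 1)).Finite ∧
      PolytopeNumbers.polytopeNumber v P n =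
        ((PolytopeNumbers.chainSums v P (n - 1)).ncard : ℤ) ∧
      PolytopeNumbers.interiorPolytopeNumber v P n =
        ((PolytopeNumbers.interiorChainSums v P (n - 1)).ncard : ℤ) := by
  obtain ⟨hnum, hint⟩ := PolytopeNumbers.polytopeNumber_eq_ncard hP hv
  refine ⟨by simp [PolytopeNumbers.polytopeNumber],
    by simp [PolytopeNumbers.interiorPolytopeNumber],
    by simp [PolytopeNumbers.polytopeNumber],
    by simp [PolytopeNumbers.interiorPolytopeNumber], fun n hn => ?_⟩
  obtain ⟨k, rfl⟩ := Nat.exists_eq_add_of_le' hn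
  exact ⟨hP.finite_chainSums v _, hnum (k + 1), hint k⟩
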